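/- For a topological space $X$ let $C_p(X)$ be the real vector space of all continuous functions $X\to\mathbb R$, and $C_p^*(X)$ its subspace of all bounded continuous functions, both with the topology of pointwise convergence (the subspace topology from $\mathbb R^X$). A space $X$ is scattered if every nonempty subset $A\subseteq X$ has a point that is isolated in $A$; $X$ is strongly $\sigma$-scattered if it is a countable union of closed subsets each of which is scattered in the subspace topology. Proposition. Let $X$ and $Y$ be metrizable spaces. Suppose that there is a continuous linear surjection $T\colon C_p(X)\to C_p(Y)$, or that there is a continuous linear surjection $T\colon C_p^*(X)\to C_p^*(Y)$. If $X$ is strongly $\sigma$-scattered, then so is $Y$. -/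

import Mathlib

/-- `C_p(X)`: the real vector space of all continuous functions `X → ℝ`. As a subspace of the
product `X → ℝ` it carries the topology of pointwise convergence. -/
abbrev CpSpace (X : Type*) [TopologicalSpace X] : Submodule ℝ (X → ℝ) :=
  continuousSubmodule X ℝ ℝ

/-- `C_p^*(X)`: the real vector space of all bounded continuous functions `X → ℝ`. As a subspace
of the product `X → ℝ` it carries the topology of pointwise convergence. -/
def CpStarSpace (X : Type*) [TopologicalSpace X] : Submodule ℝ (X → ℝ) where
  carrier := {f | Continuous f ∧ ∃ M : ℝ, ∀ x, |f x| ≤ M}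
  add_mem' := by
    rintro f g ⟨hf, M, hM⟩ ⟨hg, N, hN⟩
    exact ⟨hf.add hg, M + N, fun x => (abs_add_le (f x) (g x)).trans (add_le_add (hM x) (hN x))⟩
  zero_mem' := ⟨continuous_zero, 0, fun x => by simp⟩
  smul_mem' := by
    rintro c f ⟨hf, M, hM⟩
    refine ⟨hf.const_smul c, |c| * M, fun x => ?_⟩
    simpa [abs_mul] using mul_le_mul_of_nonneg_left (hM x) (abs_nonneg c)

/-- A space `X` is scattered if every nonempty subset `A` of `X` has a point that is isolated
in `A`. -/
def IsScatteredSpace (X : Type*) [TopologicalSpace X] : Prop :=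
  ∀ A : Set X, A.Nonempty → ∃ x ∈ A, ∃ U : Set X, IsOpen U ∧ U ∩ A = {x}

/-- A space `X` is strongly `σ`-scattered if it is the union of countably many closed subspaces,
each of which is scattered in its subspace topology. -/
def IsStronglySigmaScattered (X : Type*) [TopologicalSpace X] : Prop :=
  ∃ F : ℕ → Set X, (∀ n, IsClosed (F n)) ∧ (∀ n, IsScatteredSpace (F n)) ∧ ⋃ n, F n = Set.univ

/-! For each `y` the functional `f ↦ T f y` is a finite combination of evaluations; let `S y` be its
support. Then `S` is lower semicontinuous, and its fibres are finite: values at `|K|` points cannot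
produce arbitrary values at `|K| + 1` points. With `X` an increasing union of closed scattered `F
m`, the closed sets `{y | |S y| ≤ n, S y ⊆ F m}` cover `Y`. Each is scattered: on any nonempty
subset `A` of it, `S` is constant on a nonempty relatively open piece, which is therefore finite and
so contains an isolated point of `A`. -/

/-- A subset of a space is scattered in its subspace topology iff each of its nonempty subsets has
a point that is isolated by an open set of the ambient space. -/
theorem isScatteredSpace_coe_iff {X : Type*} [TopologicalSpace X] {F : Set X} :
    IsScatteredSpace F ↔
      ∀ A ⊆ F, A.Nonempty → ∃ x ∈ A, ∃ U : Set X, IsOpen U ∧ U ∩ A = {x} := by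
  constructor
  · intro h A hAF hA
    obtain ⟨a, ha⟩ := hA
    obtain ⟨x, hx, U, hU, hUA⟩ := h (Subtype.val ⁻¹' A) ⟨⟨a, hAF ha⟩, ha⟩
    obtain ⟨W, hW, rfl⟩ := isOpen_induced_iff.mp hU
    refine ⟨x, hx, W, hW, Set.eq_singleton_iff_unique_mem.mpr ?_⟩
    have hx' := Set.eq_singleton_iff_unique_mem.mp hUA
    exact ⟨⟨hx'.1.1, hx⟩, fun z hz => congrArg Subtype.val (hx'.2 ⟨z, hAF hz.2⟩ hz)⟩
  · intro h A hA
    obtain ⟨x, hx, U, hU, hUA⟩ := h (Subtype.val '' A) (by rintro _ ⟨z, -, rfl⟩; exact z.2)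
      (hA.image _)
    obtain ⟨x, hxA, rfl⟩ := hx
    refine ⟨x, hxA, Subtype.val ⁻¹' U, hU.preimage continuous_subtype_val, ?_⟩
    have hx' := Set.eq_singleton_iff_unique_mem.mp hUA
    exact Set.eq_singleton_iff_unique_mem.mpr
      ⟨⟨hx'.1.1, hxA⟩, fun z hz => Subtype.ext (hx'.2 z ⟨hz.1, z, hz.2, rfl⟩)⟩

theorem IsScatteredSpace.union {X : Type*} [TopologicalSpace X] {F G : Set X}
    (hF : IsScatteredSpace F) (hG : IsScatteredSpace G) (hGc : IsClosed G) :
    IsScatteredSpace (F ∪ G : Set X) := by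
  rw [isScatteredSpace_coe_iff] at *
  intro A hA hne
  by_cases hAG : A ⊆ G
  · exact hG A hAG hne
  · obtain ⟨x, hx, U, hU, hUA⟩ := hF (A \ G)
      (fun z hz => (hA hz.1).resolve_right hz.2) (Set.sdiff_nonempty.mpr hAG)
    refine ⟨x, hx.1, U \ G, hU.sdiff hGc, ?_⟩
    rw [← hUA]
    ext z
    simp only [Set.mem_inter_iff, Set.mem_sdiff]
    tauto

/-- The closed scattered sets covering a strongly `σ`-scattered space can be chosen increasing. -/
theorem IsStronglySigmaScattered.exists_monotone {X : Type*} [TopologicalSpace X]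
    (h : IsStronglySigmaScattered X) :
    ∃ F : ℕ → Set X, (∀ n, IsClosed (F n)) ∧ (∀ n, IsScatteredSpace (F n)) ∧ Monotone F ∧
      ∀ x, ∃ n, x ∈ F n := by
  obtain ⟨F, hFc, hFs, hFu⟩ := h
  have hc : ∀ n, IsClosed (Set.accumulate F n) := fun n => by
    rw [Set.accumulate_def]
    exact (Set.finite_Iic n).isClosed_biUnion fun i _ => hFc i
  refine ⟨Set.accumulate F, hc, fun n => ?_, Set.monotone_accumulate, fun x => ?_⟩
  · induction n with
    | zero =>
      rw [Set.accumulate_zero_nat]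
      exact hFs 0
    | succ n ih =>
      rw [Set.accumulate_succ]
      exact ih.union (hFs _) (hFc _)
  · obtain ⟨n, hn⟩ := Set.mem_iUnion.mp (hFu.ge (Set.mem_univ x))
    exact ⟨n, Set.subset_accumulate hn⟩

/-- A countable family of closed scattered sets, indexed by any countable type, witnesses strong
`σ`-scatteredness. -/
theorem isStronglySigmaScattered_of_countable {X ι : Type*} [TopologicalSpace X] [Countable ι]
    [Nonempty ι] (F : ι → Set X) (hc : ∀ i, IsClosed (F i)) (hs : ∀ i, IsScatteredSpace (F i))
    (hu : ∀ x, ∃ i, x ∈ F i) : IsStronglySigmaScattered X := by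
  obtain ⟨e, he⟩ := exists_surjective_nat ι
  refine ⟨F ∘ e, fun n => hc _, fun n => hs _, Set.eq_univ_of_forall fun x => ?_⟩
  obtain ⟨i, hi⟩ := hu x
  obtain ⟨n, rfl⟩ := he i
  exact Set.mem_iUnion.mpr ⟨n, hi⟩

section LowerSemicontinuousSupport

variable {X Y : Type*} [TopologicalSpace X] [TopologicalSpace Y] {S : Y → Finset X}

/-- For a lower semicontinuous finite-valued map, the set of points whose value has at most `n`
elements is closed. -/
theorem isClosed_setOf_card_le [T2Space X]
    (hS : ∀ U : Set X, IsOpen U → IsOpen {y | ∃ x ∈ S y, x ∈ U}) (n : ℕ) :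
    IsClosed {y | (S y).card ≤ n} := by
  rw [← isOpen_compl_iff, isOpen_iff_mem_nhds]
  intro y hy
  -- For `z` near `y`, `S z` meets each of these disjoint neighbourhoods, so it has at least as many
  -- points as `S y`.
  obtain ⟨U, hU, hdisj⟩ := (S y).finite_toSet.t2_separation
  have hV : ∀ᶠ z in nhds y, ∀ x ∈ S y, ∃ w ∈ S z, w ∈ U x := by
    rw [Filter.eventually_all_finset]
    exact fun x hx => (hS (U x) (hU x).2).mem_nhds ⟨x, hx, (hU x).1⟩
  filter_upwards [hV] with z hz
  simp only [Set.mem_compl_iff, Set.mem_ofPred_eq, not_le] at hy ⊢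
  refine hy.trans_le ?_
  choose! g hg hgU using hz
  refine Finset.card_le_card_of_injOn g hg fun a ha b hb hab => ?_
  by_contra hne
  exact Set.disjoint_left.mp (hdisj ha hb hne) (hgU a ha) (hab ▸ hgU b hb)

theorem isClosed_setOf_coe_subset
    (hS : ∀ U : Set X, IsOpen U → IsOpen {y | ∃ x ∈ S y, x ∈ U}) {F : Set X} (hF : IsClosed F) :
    IsClosed {y | (S y : Set X) ⊆ F} := by
  rw [← isOpen_compl_iff]
  convert hS _ hF.isOpen_compl using 1
  ext y
  simp [Set.not_subset]

/-- A lower semicontinuous map whose values are subsets of a scattered set with at most `n`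
elements is constant on some nonempty relatively open subset. -/
theorem exists_isOpen_eqOn_of_scattered [T1Space X]
    (hS : ∀ U : Set X, IsOpen U → IsOpen {y | ∃ x ∈ S y, x ∈ U}) {F : Set X}
    (hF : IsScatteredSpace F) {A : Set Y} (hA : A.Nonempty) {n : ℕ}
    (hn : ∀ y ∈ A, (S y).card ≤ n) (hAF : ∀ y ∈ A, (S y : Set X) ⊆ F) :
    ∃ V : Set Y, IsOpen V ∧ (V ∩ A).Nonempty ∧ ∃ K : Finset X, ∀ y ∈ V ∩ A, S y = K := by
  classical
  -- Grow a common part `K` of the values over a shrinking open `V`; `m` bounds how many points can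
  -- still be added.
  suffices H : ∀ (m : ℕ) (K : Finset X) (V : Set Y), IsOpen V → (V ∩ A).Nonempty →
      (∀ y ∈ V ∩ A, K ⊆ S y) → n ≤ m + K.card →
      ∃ V : Set Y, IsOpen V ∧ (V ∩ A).Nonempty ∧ ∃ K : Finset X, ∀ y ∈ V ∩ A, S y = K from
    H n ∅ Set.univ isOpen_univ (by simpa using hA) (by simp) (by simp)
  intro m
  induction m with
  | zero =>
    intro K V hV hVA hK hcard
    exact ⟨V, hV, hVA, K, fun y hy =>
      (Finset.eq_of_subset_of_card_le (hK y hy) ((hn y hy.2).trans (by simpa using hcard))).symm⟩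
  | succ m ih =>
    intro K V hV hVA hK hcard
    by_cases hB : ∀ y ∈ V ∩ A, S y ⊆ K
    · exact ⟨V, hV, hVA, K, fun y hy => (hB y hy).antisymm (hK y hy)⟩
    · push Not at hB
      obtain ⟨y₀, hy₀, hnot⟩ := hB
      obtain ⟨x₀, hx₀, hx₀K⟩ := Finset.not_subset.mp hnot
      obtain ⟨x, ⟨hxK, y₁, hy₁, hxy₁⟩, U, hU, hUB⟩ := isScatteredSpace_coe_iff.mp hF
        {x | x ∉ K ∧ ∃ y ∈ V ∩ A, x ∈ S y}
        (by rintro x ⟨-, y, hy, hx⟩; exact hAF y hy.2 hx) ⟨x₀, hx₀K, y₀, hy₀, hx₀⟩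
      have hU' := Set.eq_singleton_iff_unique_mem.mp hUB
      -- Over `V ∩ A`, the only point outside `K` that a value can have in `U` is `x`, so meeting `U
      -- \ K` forces `x ∈ S y`.
      refine ih (insert x K) (V ∩ {y | ∃ z ∈ S y, z ∈ U \ K})
        (hV.inter (hS _ (hU.sdiff K.finite_toSet.isClosed)))
        ⟨y₁, ⟨hy₁.1, x, hxy₁, hU'.1.1, hxK⟩, hy₁.2⟩ ?_ ?_
      · rintro y ⟨⟨hyV, z, hz, hzU, hzK⟩, hyA⟩
        obtain rfl := hU'.2 z ⟨hzU, hzK, y, ⟨hyV, hyA⟩, hz⟩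
        exact Finset.insert_subset hz (hK y ⟨hyV, hyA⟩)
      · rw [Finset.card_insert_of_notMem hxK]
        omega

/-- The preimage of strong `σ`-scatteredness under a lower semicontinuous map with finite values
all of whose fibres are finite. -/
theorem IsStronglySigmaScattered.of_finite_fibers [T2Space X] [T1Space Y]
    (hX : IsStronglySigmaScattered X)
    (hS : ∀ U : Set X, IsOpen U → IsOpen {y | ∃ x ∈ S y, x ∈ U})
    (hfib : ∀ K : Finset X, {y | S y = K}.Finite) : IsStronglySigmaScattered Y := by
  obtain ⟨F, hFc, hFs, hFm, hFu⟩ := hX.exists_monotone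
  refine isStronglySigmaScattered_of_countable
    (fun p : ℕ × ℕ => {y | (S y).card ≤ p.1} ∩ {y | (S y : Set X) ⊆ F p.2})
    (fun p => (isClosed_setOf_card_le hS _).inter (isClosed_setOf_coe_subset hS (hFc _)))
    (fun p => isScatteredSpace_coe_iff.mpr fun A hA hne => ?_) fun y => ?_
  · obtain ⟨V, hV, ⟨y, hyV, hyA⟩, K, hK⟩ := exists_isOpen_eqOn_of_scattered hS (hFs p.2) hne
      (fun y hy => (hA hy).1) (fun y hy => (hA hy).2)
    have hfin : (V ∩ A).Finite := (hfib K).subset hK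
    refine ⟨y, hyA, V \ ((V ∩ A) \ {y}), hV.sdiff hfin.sdiff.isClosed, ?_⟩
    ext z
    simp only [Set.mem_inter_iff, Set.mem_sdiff, Set.mem_singleton_iff]
    constructor
    · tauto
    · rintro rfl
      tauto
  · choose g hg using hFu
    refine ⟨((S y).card, (S y).sup g), le_refl (S y).card, fun x hx => ?_⟩
    exact hFm (Finset.le_sup hx) (hg x)

end LowerSemicontinuousSupport

/-- A continuous linear functional on a space of functions with the topology of pointwise
convergence is a finite linear combination of evaluations. -/
theorem ContinuousLinearMap.exists_finsupp_eval {X : Type*} {E : Submodule ℝ (X → ℝ)}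
    (φ : E →L[ℝ] ℝ) : ∃ c : X →₀ ℝ, ∀ f : E, φ f = c.sum fun x a => a * (f : X → ℝ) x := by
  have h : φ.toLinearMap ∈ Submodule.span ℝ
      (Set.range fun x : X => (LinearMap.proj x : (X → ℝ) →ₗ[ℝ] ℝ) ∘ₗ E.subtype) := by
    rw [LinearMap.mem_span_iff_continuous]
    convert φ.continuous using 1
    · simp only [instTopologicalSpaceSubtype, Pi.topologicalSpace, induced_iInf, induced_compose]
      rfl
    · rfl
  obtain ⟨c, hc⟩ := Finsupp.mem_span_range_iff_exists_finsupp.mp h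
  refine ⟨c, fun f => ?_⟩
  have := LinearMap.congr_fun hc f
  simp only [Finsupp.sum, LinearMap.sum_apply] at this ⊢
  exact this.symm

theorem exists_mem_cpStarSpace_eq_one {X : Type*} [TopologicalSpace X] [CompletelyRegularSpace X]
    {U : Set X} (hU : IsOpen U) {x : X} (hx : x ∈ U) :
    ∃ f ∈ CpStarSpace X, f x = 1 ∧ ∀ z ∉ U, f z = 0 := by
  obtain ⟨f, hf, hfx, hfU⟩ := CompletelyRegularSpace.completely_regular_isOpen x U hU hx
  refine ⟨fun z => 1 - (f z : ℝ), ⟨by fun_prop, 1, fun z => ?_⟩, by simp [hfx],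
    fun z hz => by simp [hfU hz]⟩
  rw [abs_le]
  constructor <;> linarith [(f z).2.1, (f z).2.2]

/-- Bounded continuous functions interpolate arbitrary values on finite sets. -/
theorem exists_mem_cpStarSpace_eq_on_finset {X : Type*} [TopologicalSpace X] [T35Space X]
    (B : Finset X) (v : X → ℝ) : ∃ f ∈ CpStarSpace X, ∀ x ∈ B, f x = v x := by
  classical
  have h : ∀ x : X, ∃ f ∈ CpStarSpace X, f x = 1 ∧ ∀ z ∈ B.erase x, f z = 0 := fun x => by
    obtain ⟨f, hf, hfx, hfU⟩ := exists_mem_cpStarSpace_eq_one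
      (B.erase x).finite_toSet.isClosed.isOpen_compl (x := x) (by simp)
    exact ⟨f, hf, hfx, fun z hz => hfU z (by simpa [and_comm] using hz)⟩
  choose b hb hb1 hb0 using h
  refine ⟨∑ x ∈ B, v x • b x,
    Submodule.sum_mem _ fun x _ => Submodule.smul_mem _ _ (hb x), fun x hx => ?_⟩
  rw [Finset.sum_apply, Finset.sum_eq_single_of_mem x hx]
  · simp [hb1]
  · intro z _ hzx
    simp [hb0 z x (Finset.mem_erase.mpr ⟨hzx.symm, hx⟩)]

/-- A continuous linear surjection between spaces of continuous functions that contain all bounded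
ones transports strong `σ`-scatteredness from the domain space to the target space. -/
theorem IsStronglySigmaScattered.of_surjective {X Y : Type*} [TopologicalSpace X]
    [TopologicalSpace Y] [T35Space X] [T35Space Y] (hX : IsStronglySigmaScattered X)
    {E : Submodule ℝ (X → ℝ)} {G : Submodule ℝ (Y → ℝ)} (hE : CpStarSpace X ≤ E)
    (hG : CpStarSpace Y ≤ G) (hG' : ∀ g ∈ G, Continuous g) (T : E →L[ℝ] G)
    (hT : Function.Surjective T) : IsStronglySigmaScattered Y := by
  classical
  have hrep : ∀ y : Y, ∃ c : X →₀ ℝ, ∀ f : E,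
      (T f : Y → ℝ) y = c.sum fun x a => a * (f : X → ℝ) x := fun y =>
    (((ContinuousLinearMap.proj y : (Y → ℝ) →L[ℝ] ℝ).comp G.subtypeL).comp T).exists_finsupp_eval
  choose c hc using hrep
  refine hX.of_finite_fibers (S := fun y => (c y).support) (fun U hU => ?_) fun K => ?_
  · rw [isOpen_iff_mem_nhds]
    rintro y ⟨x, hx, hxU⟩
    -- Deleting the other support points makes `T f y` equal to the nonzero coefficient `c y x`,
    -- while `T f z = 0` whenever the support at `z` misses `U`.
    obtain ⟨f, hf, hfx, hfU⟩ := exists_mem_cpStarSpace_eq_one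
      (hU.sdiff ((c y).support.erase x).finite_toSet.isClosed) (x := x) ⟨hxU, by simp⟩
    have hfy : (T ⟨f, hE hf⟩ : Y → ℝ) y ≠ 0 := by
      rw [hc, Finsupp.sum, Finset.sum_eq_single_of_mem x hx]
      · simpa [hfx] using hx
      · intro z hz hzx
        have : f z = 0 := hfU z fun h => h.2 (Finset.mem_erase.mpr ⟨hzx, hz⟩)
        simp [this]
    filter_upwards [((hG' _ (T ⟨f, hE hf⟩).2).continuousAt).eventually_ne hfy] with z hz
    by_contra hcon
    refine hz ?_
    rw [hc, Finsupp.sum]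
    refine Finset.sum_eq_zero fun w hw => ?_
    have : f w = 0 := hfU w fun h => hcon ⟨w, hw, h.1⟩
    simp [this]
  · by_contra hinf
    obtain ⟨B, hBK, hBcard⟩ := Set.Infinite.exists_subset_card_eq hinf (K.card + 1)
    -- On `B`, `T f` depends only on `f` restricted to `K`, through this matrix; surjectivity of `T`
    -- would give a surjection onto a space of larger dimension.
    let L : (K → ℝ) →ₗ[ℝ] (B → ℝ) :=
      Matrix.mulVecLin (Matrix.of fun (y : B) (x : K) => c y x)
    have hL : Function.Surjective L := fun v => by
      obtain ⟨g, hg, hgv⟩ :=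
        exists_mem_cpStarSpace_eq_on_finset B fun y => if h : y ∈ B then v ⟨y, h⟩ else 0
      obtain ⟨f, hf⟩ := hT ⟨g, hG hg⟩
      refine ⟨fun x => (f : X → ℝ) x, funext fun y => ?_⟩
      have hy : (c y).support = K := hBK y.2
      have h := hc y f
      rw [hf, Finsupp.sum, hy, ← Finset.sum_coe_sort] at h
      have hgy := hgv y y.2
      simp only [y.2, dite_true] at hgy
      rw [← hgy]
      exact h.symm
    have := LinearMap.finrank_le_finrank_of_surjective hL
    simp [hBcard] at this

theorem proposition4p3 {X : Type*} {Y : Type*} [TopologicalSpace X] [TopologicalSpace Y]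
    [TopologicalSpace.MetrizableSpace X] [TopologicalSpace.MetrizableSpace Y]
    (hX : IsStronglySigmaScattered X) :
    (∀ T : CpSpace X →L[ℝ] CpSpace Y, Function.Surjective T → IsStronglySigmaScattered Y) ∧
    (∀ T : CpStarSpace X →L[ℝ] CpStarSpace Y, Function.Surjective T →
      IsStronglySigmaScattered Y) :=
  ⟨fun T hT => hX.of_surjective (fun _ h => h.1) (fun _ h => h.1) (fun _ h => h) T hT,
    fun T hT => hX.of_surjective le_rfl le_rfl (fun _ h => h.1) T hT⟩
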